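/- Let $\mathcal L$ be a finite relational language. A class $\mathcal C$ of finite $\mathcal L$-structures is a *Fraïssé class* if it contains countably infinitely many isomorphism types, is closed under isomorphism, and has the hereditary property, the joint embedding property and the amalgamation property. Given finite $\mathcal L$-structures $A \subseteq B_1$ and $A \subseteq B_2$, the *free amalgam* of $B_1$ and $B_2$ over $A$ is the $\mathcal L$-structure $C$ whose domain is the disjoint union of $B_1$ and $B_2$ over $A$, with $R^C = R^{B_1} \cup R^{B_2}$ for every relation symbol $R \in \mathcal L$. A *free amalgamation class* is a Fraïssé class that is closed under taking free amalgams, and a *free homogeneous structure* is the Fraïssé limit of a free amalgamation class $\mathcal C$, that is, a countable $\mathcal L$-structure $M$ such that every isomorphism between finite substructures of $M$ extends to an automorphism of $M$, and such that $\mathcal C$ is the class of all finite $\mathcal L$-structures embeddable in $M$. Let $M$ be a free homogeneous structure over the finite relational language $\mathcal L$, and equip $\mathrm{Aut}(M)$ with the pointwise convergence topology (whose basic open sets are the cosets of the pointwise stabilisers of finite subsets of $M$). Then $\mathrm{Aut}(M)$ contains a dense locally finite subgroup, that is, a dense subgroup $H$ such that every finitely generated subgroup of $H$ is finite. -/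

import Mathlib

universe u v w

open scoped FirstOrder

namespace FreeHomogeneous

open FirstOrder FirstOrder.Language CategoryTheory

section Automorphisms

variable {L : FirstOrder.Language.{u, v}} {M : Type w} [L.Structure M]

/-- The group structure on `Aut(M)`: multiplication is composition of automorphisms. -/
instance autGroup : Group (M ≃[L] M) where
  mul g h := g.comp h
  one := FirstOrder.Language.Equiv.refl L M
  inv g := g.symm
  mul_assoc _ _ _ := rfl
  one_mul _ := rfl
  mul_one _ := rfl
  inv_mul_cancel g := FirstOrder.Language.Equiv.ext fun x => g.toEquiv.symm_apply_apply x

/-- The pointwise convergence topology on `Aut(M)`: the topology induced by the product topology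
on `M → M`, where `M` is discrete. -/
instance autTopology : TopologicalSpace (M ≃[L] M) :=
  TopologicalSpace.induced (fun g : M ≃[L] M => (g : M → M))
    (@Pi.topologicalSpace M (fun _ => M) fun _ => ⊥)

end Automorphisms

/-- A group is locally finite if each of its finitely generated subgroups is finite. -/
def IsLocallyFiniteGroup (G : Type*) [Group G] : Prop :=
  ∀ S : Subgroup G, S.FG → Finite S

section FreeAmalgamation

variable {L : FirstOrder.Language.{u, v}}

/-- `C`, together with `f₁ : B₁ → C` and `f₂ : B₂ → C`, is the free amalgam of `B₁` and `B₂` over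
`A`, where `A` is viewed as a substructure of `B₁` and of `B₂` via `e₁` and `e₂`: the domain of `C`
is the disjoint union of `B₁` and `B₂` over `A`, and `R^C = R^{B₁} ∪ R^{B₂}` for every relation
symbol `R`. -/
structure IsFreeAmalgam {A B₁ B₂ C : Type w} [L.Structure A] [L.Structure B₁] [L.Structure B₂]
    [L.Structure C] (e₁ : A ↪[L] B₁) (e₂ : A ↪[L] B₂) (f₁ : B₁ ↪[L] C) (f₂ : B₂ ↪[L] C) :
    Prop where
  comm : ∀ a : A, f₁ (e₁ a) = f₂ (e₂ a)
  cover : ∀ c : C, c ∈ Set.range f₁ ∨ c ∈ Set.range f₂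
  inter : ∀ (b₁ : B₁) (b₂ : B₂), f₁ b₁ = f₂ b₂ → ∃ a : A, e₁ a = b₁ ∧ e₂ a = b₂
  rel : ∀ {n : ℕ} (R : L.Relations n) (c : Fin n → C), Structure.RelMap R c ↔
    (∃ b : Fin n → B₁, Structure.RelMap R b ∧ c = f₁ ∘ b) ∨
      (∃ b : Fin n → B₂, Structure.RelMap R b ∧ c = f₂ ∘ b)

/-- The free amalgamation property: `K` is closed under taking free amalgams. -/
def FreeAmalgamationProperty (K : Set (Bundled.{w} L.Structure)) : Prop :=
  ∀ (A B₁ B₂ C : Bundled.{w} L.Structure) (e₁ : A ↪[L] B₁) (e₂ : A ↪[L] B₂) (f₁ : B₁ ↪[L] C)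
    (f₂ : B₂ ↪[L] C), A ∈ K → B₁ ∈ K → B₂ ∈ K → IsFreeAmalgam e₁ e₂ f₁ f₂ → C ∈ K

/-- A free amalgamation class (of finite structures in a relational language): a Fraïssé class,
containing infinitely many isomorphism types, with the free amalgamation property. In a relational
language the finitely generated structures are exactly the finite ones, and countability of the
set of isomorphism types and closure under isomorphism are part of `IsFraisse`. -/
structure IsFreeAmalgamationClass (K : Set (Bundled.{w} L.Structure)) : Prop where
  fraisse : IsFraisse K
  infinite_types : (Quotient.mk' '' K).Infinite
  free : FreeAmalgamationProperty K

/-- A free homogeneous structure: the Fraïssé limit of a free amalgamation class. -/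
def IsFreeHomogeneous (L : FirstOrder.Language.{u, v}) [L.IsRelational] (M : Type w)
    [L.Structure M] [Countable M] : Prop :=
  ∃ K : Set (Bundled.{w} L.Structure), IsFreeAmalgamationClass K ∧ IsFraisseLimit K M

end FreeAmalgamation

end FreeHomogeneous

/-!
The group is the union of a chain of finite groups. Exhaust `M` by a chain of finite substructures
`S 0 ⊆ S 1 ⊆ ...` such that every partial automorphism of `S i` extends to an automorphism of
`S (i + 1)`, and such that `Aut (S i)` acts on `S (i + 1)` by extensions, through a homomorphism
`Aut (S i) → Aut (S (i + 1))`. Iterating these homomorphisms extends every automorphism of `S i` to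
an automorphism of `M`, and the image of `Aut (S i)` in `Aut M` is a finite group that grows with
`i`. The union of the images is locally finite. It is dense because, by the extension property, it
approximates every automorphism of `M` on every finite set.

The finite step is `exists_finite_extension`. A finite structure `T` in `M` is extended twice.

* `FlipExt L T` consists of points of `T` with flips in `ZMod 2`; a relation holds at a tuple if the
  relation of `T`, corrected by the sum of the flips, does. A partial automorphism of `T`, extended
  arbitrarily to a permutation of `T`, becomes an automorphism once the flips make up for the tuples
  at which the relation is not preserved. The resulting corrections are coboundaries, so that a
  group of automorphisms of a substructure `S` of `T` acts (`liftFun_comp`). This proves the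
  extension property for the class of all finite structures.
* `CliqueExt L M B G`, following Hodkinson and Otto, returns to the given class. Each point of
  `B = FlipExt L T` receives, for each subset `u` of `B` that contains it and does not embed in `M`,
  one of `|u| - 1` colours, and points are related only if their colours differ. By the pigeonhole
  principle, cliques project to sets that embed in `M` (`CliqueExt.embedsOn_of_clique`), whereas `T`
  survives, as it contains none of the sets `u` (`CliqueExt.exists_lift`). Partial automorphisms are
  still extended (`CliqueExt.exists_aut_extending`), by permuting colours.

Finally, a finite structure whose cliques embed in `M` is built from them by free amalgamation and
hence embeds in `M` (`embedsOn_of_forall_clique`), over `T` by homogeneity. This is the only use of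
free amalgamation.
-/

namespace FreeHomogeneous

open FirstOrder FirstOrder.Language FirstOrder.Language.Structure CategoryTheory
open scoped Classical

/-! ### Extending injections between finite sets -/

section Finite

variable {X Y : Type*}

theorem exists_perm_of_injective [Finite Y] {f g : X → Y} (hf : f.Injective) (hg : g.Injective) :
    ∃ θ : Equiv.Perm Y, ∀ x, θ (f x) = g x := by
  let e : {y // y ∈ Set.range f} ≃ {y // y ∈ Set.range g} :=
    (Equiv.ofInjective f hf).symm.trans (Equiv.ofInjective g hg)
  have := Fintype.ofFinite Y
  refine ⟨e.extendSubtype, fun x => ?_⟩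
  rw [Equiv.extendSubtype_apply_of_mem e (f x) ⟨x, rfl⟩]
  have : (Equiv.ofInjective f hf).symm ⟨f x, x, rfl⟩ = x := Equiv.ofInjective_symm_apply hf x
  simp [e, this]

theorem exists_perm_of_injOn {Q : Finset Y} {D : Set X} {f g : X → Y} (hf : D.InjOn f)
    (hg : D.InjOn g) (hfQ : ∀ x ∈ D, f x ∈ Q) (hgQ : ∀ x ∈ D, g x ∈ Q) :
    ∃ θ : Equiv.Perm Y, (∀ x ∈ D, θ (f x) = g x) ∧ (∀ y ∈ Q, θ y ∈ Q) ∧ ∀ y ∉ Q, θ y = y := by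
  let f' : D → Q := fun x => ⟨f x, hfQ x x.2⟩
  let g' : D → Q := fun x => ⟨g x, hgQ x x.2⟩
  have hf' : f'.Injective := fun x y h => Subtype.ext (hf x.2 y.2 (congrArg Subtype.val h))
  have hg' : g'.Injective := fun x y h => Subtype.ext (hg x.2 y.2 (congrArg Subtype.val h))
  obtain ⟨θ, hθ⟩ := exists_perm_of_injective hf' hg'
  refine ⟨Equiv.Perm.ofSubtype θ, fun x hx => ?_, fun y hy => ?_, fun y hy => ?_⟩
  · rw [Equiv.Perm.ofSubtype_apply_of_mem (p := (· ∈ Q)) θ (hfQ x hx)]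
    exact congrArg Subtype.val (hθ ⟨x, hx⟩)
  · rw [Equiv.Perm.ofSubtype_apply_of_mem (p := (· ∈ Q)) θ hy]
    exact (θ ⟨y, hy⟩).2
  · exact Equiv.Perm.ofSubtype_apply_of_not_mem (p := (· ∈ Q)) θ hy

theorem exists_injOn_extension {s t : Finset X} {Q : Finset Y} {f : X → Y} (hst : s ⊆ t)
    (hf : Set.InjOn f s) (hfQ : ∀ x ∈ s, f x ∈ Q) (hcard : t.card ≤ Q.card) :
    ∃ f' : X → Y, Set.InjOn f' t ∧ (∀ x ∈ t, f' x ∈ Q) ∧ ∀ x, x ∉ t \ s → f' x = f x := by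
  have hc : Fintype.card ↥(t \ s) ≤ Fintype.card ↥(Q \ s.image f) := by
    rw [Fintype.card_coe, Fintype.card_coe, Finset.card_sdiff_of_subset hst,
      Finset.card_sdiff_of_subset (by
        intro y hy
        obtain ⟨x, hx, rfl⟩ := Finset.mem_image.1 hy
        exact hfQ x hx),
      Finset.card_image_of_injOn hf]
    omega
  obtain ⟨k⟩ := Function.Embedding.nonempty_of_card_le hc
  have hk : ∀ x, (k x : Y) ∈ Q ∧ ∀ y ∈ s, f y ≠ k x := fun x => by
    obtain ⟨h₁, h₂⟩ := Finset.mem_sdiff.1 (k x).2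
    exact ⟨h₁, fun y hy h => h₂ (Finset.mem_image.2 ⟨y, hy, h⟩)⟩
  refine ⟨fun x => if h : x ∈ t \ s then k ⟨x, h⟩ else f x, ?_, ?_, ?_⟩
  · intro x hx y hy hxy
    rw [Finset.mem_coe] at hx hy
    by_cases hxs : x ∈ s <;> by_cases hys : y ∈ s <;> simp [hx, hy, hxs, hys] at hxy
    · exact hf hxs hys hxy
    · exact absurd hxy ((hk _).2 x hxs)
    · exact absurd hxy.symm ((hk _).2 y hys)
    · exact hxy
  · intro x hx
    by_cases hxs : x ∈ s
    · simpa [hxs] using hfQ x hxs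
    · simpa [hxs, hx] using (hk _).1
  · intro x hx
    simp only [hx, dite_false]

end Finite

/-! ### Finite structures embeddable in a free homogeneous structure -/

variable {L : FirstOrder.Language.{u, v}}

/-- The substructure of `X` on the finite set `s` embeds in `M`. The embedding is encoded by a map
defined on all of `X`, of which only the values on `s` matter. -/
def EmbedsOn (M : Type*) [L.Structure M] {X : Type*} [L.Structure X] (s : Finset X) : Prop :=
  ∃ f : X → M, Set.InjOn f s ∧ ∀ (n : ℕ) (R : L.Relations n) (t : Fin n → X), (∀ i, t i ∈ s) →
    (RelMap R (f ∘ t) ↔ RelMap R t)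

/-- The permutation `σ` preserves all relations and their complements. -/
def IsAut {X : Type*} [L.Structure X] (σ : Equiv.Perm X) : Prop :=
  ∀ (n : ℕ) (R : L.Relations n) (t : Fin n → X), RelMap R (σ ∘ t) ↔ RelMap R t

theorem EmbedsOn.mono {M X : Type*} [L.Structure M] [L.Structure X] {s s' : Finset X}
    (h : EmbedsOn (L := L) M s) (hs : s' ⊆ s) : EmbedsOn (L := L) M s' := by
  obtain ⟨f, hf, hR⟩ := h
  exact ⟨f, hf.mono hs, fun n R t ht => hR n R t fun i => hs (ht i)⟩

theorem EmbedsOn.image {M X : Type*} [L.Structure M] [L.Structure X] {s : Finset X}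
    (h : EmbedsOn (L := L) M s) {σ : Equiv.Perm X} (hσ : IsAut (L := L) σ) :
    EmbedsOn (L := L) M (s.image σ) := by
  obtain ⟨f, hf, hR⟩ := h
  have key : ∀ x ∈ s.image σ, σ.symm x ∈ s := by
    intro x hx
    obtain ⟨y, hy, rfl⟩ := Finset.mem_image.1 hx
    simpa using hy
  refine ⟨f ∘ σ.symm, ?_, fun n R t ht => ?_⟩
  · intro x hx y hy hxy
    exact σ.symm.injective (hf (key x hx) (key y hy) hxy)
  · rw [Function.comp_assoc, hR n R (σ.symm ∘ t) fun i => key _ (ht i), ← hσ n R,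
      ← Function.comp_assoc]
    simp

theorem IsAut.symm {X : Type*} [L.Structure X] {σ : Equiv.Perm X} (h : IsAut (L := L) σ) :
    IsAut (L := L) σ.symm := by
  intro n R t
  rw [← h n R, ← Function.comp_assoc]
  simp

theorem embedsOn_image_iff {M X : Type*} [L.Structure M] [L.Structure X] {s : Finset X}
    {σ : Equiv.Perm X} (hσ : IsAut (L := L) σ) :
    EmbedsOn (L := L) M (s.image σ) ↔ EmbedsOn (L := L) M s := by
  refine ⟨fun h => ?_, fun h => h.image hσ⟩
  have := h.image hσ.symm
  rwa [Finset.image_image, σ.symm_comp_self, Finset.image_id] at this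

variable [L.IsRelational]

/-- The structure on `Y` pulled back along a map `j : Y → X`. -/
abbrev pullback {X Y : Type*} [L.Structure X] (j : Y → X) : L.Structure Y where
  funMap f := isEmptyElim f
  RelMap R t := RelMap R (j ∘ t)

/-- An injection that preserves all relations and their complements, as an embedding. -/
def mkEmbedding {X Y : Type*} [L.Structure X] [L.Structure Y] (f : X → Y)
    (hf : f.Injective)
    (hR : ∀ (n : ℕ) (R : L.Relations n) (t : Fin n → X), RelMap R (f ∘ t) ↔ RelMap R t) :
    X ↪[L] Y where
  toFun := f
  inj' := hf
  map_fun' g := isEmptyElim g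
  map_rel' R t := hR _ R t

theorem pullback_mem_age {M : Type w} [L.Structure M] {X : Type*} [L.Structure X] {Y : Type w}
    [Finite Y] {j : Y → X} (hj : j.Injective) {s : Finset X} (hs : ∀ y, j y ∈ s)
    (h : EmbedsOn (L := L) M s) : (⟨Y, pullback j⟩ : Bundled.{w} L.Structure) ∈ L.age M := by
  obtain ⟨f, hf, hR⟩ := h
  let : L.Structure Y := pullback j
  exact ⟨Structure.FG.of_finite, ⟨mkEmbedding (f ∘ j) (fun x y h => hj (hf (hs x) (hs y) h))
    fun n R t => hR n R (j ∘ t) fun i => hs _⟩⟩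

/-- Free amalgamation, for a free amalgam `s` of its subsets `s₁` and `s₂` over `s₁ ∩ s₂`. -/
theorem EmbedsOn.amalgam {M : Type w} [L.Structure M]
    (hM : FreeAmalgamationProperty (L.age M)) {X : Type*} [L.Structure X]
    {s s₁ s₂ : Finset X} (h₁ : EmbedsOn (L := L) M s₁) (h₂ : EmbedsOn (L := L) M s₂)
    (hs : s = s₁ ∪ s₂)
    (hR : ∀ (n : ℕ) (R : L.Relations n) (t : Fin n → X), (∀ i, t i ∈ s) → RelMap R t →
      (∀ i, t i ∈ s₁) ∨ ∀ i, t i ∈ s₂) :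
    EmbedsOn (L := L) M s := by
  -- a copy of `s` in the universe of `M`
  have : Small.{w} s := Countable.toSmall s
  let Y : Type w := Shrink.{w} s
  let c : Y → X := fun y => ((equivShrink s).symm y : X)
  have hc : c.Injective := fun x y h => (equivShrink s).symm.injective (Subtype.ext h)
  have hcs : ∀ y, c y ∈ s := fun y => ((equivShrink s).symm y).2
  have hYfin : Finite Y := Finite.of_equiv s (equivShrink s)
  let Y₁ := {y : Y // c y ∈ s₁}
  let Y₂ := {y : Y // c y ∈ s₂}
  let Y₀ := {y : Y // c y ∈ s₁ ∧ c y ∈ s₂}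
  let : L.Structure Y := pullback c
  let : L.Structure Y₁ := pullback fun y => c y.1
  let : L.Structure Y₂ := pullback fun y => c y.1
  let : L.Structure Y₀ := pullback fun y => c y.1
  let e₁ : Y₀ ↪[L] Y₁ := mkEmbedding (fun y => ⟨y.1, y.2.1⟩)
    (fun x y h => Subtype.ext (Subtype.mk.inj h)) fun _ _ _ => Iff.rfl
  let e₂ : Y₀ ↪[L] Y₂ := mkEmbedding (fun y => ⟨y.1, y.2.2⟩)
    (fun x y h => Subtype.ext (Subtype.mk.inj h)) fun _ _ _ => Iff.rfl
  let f₁ : Y₁ ↪[L] Y := mkEmbedding Subtype.val Subtype.val_injective fun _ _ _ => Iff.rfl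
  let f₂ : Y₂ ↪[L] Y := mkEmbedding Subtype.val Subtype.val_injective fun _ _ _ => Iff.rfl
  have hfree : IsFreeAmalgam e₁ e₂ f₁ f₂ := by
    refine ⟨fun _ => rfl, fun y => ?_, ?_, fun {n} R t => ⟨fun h => ?_, ?_⟩⟩
    · have := hcs y
      rw [hs, Finset.mem_union] at this
      exact this.imp (fun h => ⟨⟨y, h⟩, rfl⟩) fun h => ⟨⟨y, h⟩, rfl⟩
    · rintro ⟨y, hy⟩ ⟨y', hy'⟩ (rfl : y = y')
      exact ⟨⟨y, hy, hy'⟩, rfl, rfl⟩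
    · exact (hR n R (c ∘ t) (fun i => hcs _) h).imp
        (fun hi => ⟨fun i => ⟨t i, hi i⟩, h, rfl⟩) fun hi => ⟨fun i => ⟨t i, hi i⟩, h, rfl⟩
    · rintro (⟨b, hb, rfl⟩ | ⟨b, hb, rfl⟩) <;> exact hb
  obtain ⟨-, ⟨g⟩⟩ := hM ⟨Y₀, inferInstance⟩ ⟨Y₁, inferInstance⟩ ⟨Y₂, inferInstance⟩
    ⟨Y, inferInstance⟩ e₁ e₂ f₁ f₂
    (pullback_mem_age (hc.comp Subtype.val_injective) (fun y => y.2.1) h₁)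
    (pullback_mem_age (hc.comp Subtype.val_injective) (fun y => y.2) h₁)
    (pullback_mem_age (hc.comp Subtype.val_injective) (fun y => y.2) h₂) hfree
  rcases s.eq_empty_or_nonempty with rfl | ⟨x₀, hx₀⟩
  · rw [eq_comm, Finset.union_eq_empty] at hs
    rwa [hs.1] at h₁
  let d : X → Y := fun x => if h : x ∈ s then equivShrink s ⟨x, h⟩ else equivShrink s ⟨x₀, hx₀⟩
  have hcd : ∀ x ∈ s, c (d x) = x := fun x hx => by simp [c, d, hx]
  refine ⟨g ∘ d, ?_, fun n R t ht => ?_⟩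
  · intro x hx y hy hxy
    rw [← hcd x hx, ← hcd y hy, g.injective hxy]
  · have hg : RelMap R (g ∘ (d ∘ t)) ↔ RelMap R (d ∘ t) := g.map_rel R (d ∘ t)
    have hct : c ∘ (d ∘ t) = t := funext fun i => hcd _ (ht i)
    rw [Function.comp_assoc, hg]
    change RelMap R (c ∘ (d ∘ t)) ↔ _
    rw [hct]

/-- A set is a clique if any two distinct points of it lie in a tuple of the ambient structure
belonging to some relation. -/
def IsRelClique (L : FirstOrder.Language.{u, v}) {X : Type*} [L.Structure X] (s : Finset X) :
    Prop :=
  ∀ x ∈ s, ∀ y ∈ s, x ≠ y → ∃ (n : ℕ) (R : L.Relations n) (t : Fin n → X),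
    RelMap R t ∧ x ∈ Set.range t ∧ y ∈ Set.range t

/-- A finite structure is assembled from its cliques by free amalgamation: if `x` and `y` are
distinct and not related, then `s` is the free amalgam of `s \ {x}` and `s \ {y}`. -/
theorem embedsOn_of_forall_clique {M : Type w} [L.Structure M]
    (hM : FreeAmalgamationProperty (L.age M)) {X : Type*} [L.Structure X]
    (h : ∀ s : Finset X, IsRelClique L s → EmbedsOn (L := L) M s) (s : Finset X) :
    EmbedsOn (L := L) M s := by
  induction s using Finset.strongInduction with
  | H s ih =>
    by_cases hs : IsRelClique L s
    · exact h s hs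
    · unfold IsRelClique at hs
      push Not at hs
      obtain ⟨x, hx, y, hy, hxy, hR⟩ := hs
      refine (ih _ (Finset.erase_ssubset hx)).amalgam hM (ih _ (Finset.erase_ssubset hy)) ?_ ?_
      · ext z
        simp only [Finset.mem_union, Finset.mem_erase]
        by_cases hz : z = x
        · subst hz; simp [hxy, hx]
        · simp [hz]
      · intro n R t ht hRt
        by_cases hxt : x ∈ Set.range t
        · refine Or.inr fun i => Finset.mem_erase.2 ⟨fun hi => ?_, ht i⟩
          exact hR n R t hRt hxt ⟨i, hi⟩
        · exact Or.inl fun i => Finset.mem_erase.2 ⟨fun hi => hxt ⟨i, hi⟩, ht i⟩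

/-! ### Extending partial automorphisms by flipping relations -/

section Flip

variable (L : FirstOrder.Language.{u, v}) (T : Type*)

/-- Pairs of a point `x` of `T` and a system of flips: for a relation symbol, a tuple `t` and a
position `i`, an element of `ZMod 2` that is only used when `x` is the `i`-th entry of `t`. -/
def FlipExt : Type _ :=
  T × (∀ r : Σ n, L.Relations n, (Fin r.1 → T) → Fin r.1 → ZMod 2)

instance [Finite T] [Finite (Σ n, L.Relations n)] : Finite (FlipExt L T) :=
  inferInstanceAs (Finite (T × _))

variable {L T}

/-- The canonical copy of `T` in `FlipExt L T`: all flips are zero. -/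
def zeroFlip (x : T) : FlipExt L T := (x, 0)

theorem zeroFlip_injective : (zeroFlip (L := L) (T := T)).Injective :=
  fun _ _ h => congrArg Prod.fst h

variable [L.Structure T]

/-- The truth value of a relation, as an element of `ZMod 2`. -/
noncomputable def ind {n : ℕ} (R : L.Relations n) (t : Fin n → T) : ZMod 2 :=
  if RelMap R t then 1 else 0

theorem ind_congr {n : ℕ} {R : L.Relations n} {s t : Fin n → T} (h : RelMap R s ↔ RelMap R t) :
    ind R s = ind R t := by
  simp [ind, h]

/-- The flip needed to make `φ` preserve `R` at `t`, charged to the first entry of `t` outside the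
set `D`. -/
noncomputable def flip (φ : Equiv.Perm T) (D : Set T) {n : ℕ} (R : L.Relations n) (t : Fin n → T)
    (i : Fin n) : ZMod 2 :=
  if t i ∉ D ∧ ∀ j < i, t j ∈ D then ind R t + ind R (φ ∘ t) else 0

theorem sum_flip {φ : Equiv.Perm T} {D : Set T}
    (hφ : ∀ (n : ℕ) (R : L.Relations n) (t : Fin n → T), (∀ i, t i ∈ D) →
      (RelMap R (φ ∘ t) ↔ RelMap R t)) {n : ℕ} (R : L.Relations n) (t : Fin n → T) :
    ∑ i, flip φ D R t i = ind R t + ind R (φ ∘ t) := by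
  by_cases h : ∀ i, t i ∈ D
  · rw [ind_congr (hφ n R t h), CharTwo.add_self_eq_zero]
    exact Finset.sum_eq_zero fun i _ => by simp [flip, h]
  · push Not at h
    obtain ⟨i, hi, hmin⟩ := wellFounded_lt.has_min {i | t i ∉ D} h
    have hlt : ∀ j < i, t j ∈ D := fun j hj => by
      by_contra hjD
      exact hmin j hjD hj
    rw [Finset.sum_eq_single i]
    · exact if_pos ⟨hi, hlt⟩
    · intro j _ hji
      refine if_neg fun hj => ?_
      rcases lt_or_gt_of_ne hji with hlt' | hlt'
      · exact hj.1 (hlt j hlt')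
      · exact hi (hj.2 i hlt')
    · exact fun h => absurd (Finset.mem_univ i) h

/-- The map of `FlipExt L T` induced by a permutation `φ` of `T` that is a partial automorphism on
`D`. -/
noncomputable def liftFun (φ : Equiv.Perm T) (D : Set T) (x : FlipExt L T) : FlipExt L T :=
  (φ x.1, fun r t i => x.2 r (φ.symm ∘ t) i +
    flip φ D r.2 (Function.update (φ.symm ∘ t) i x.1) i)

theorem liftFun_one (D : Set T) (x : FlipExt L T) : liftFun 1 D x = x := by
  refine Prod.ext rfl ?_
  funext r t i
  have : ∀ s, flip (1 : Equiv.Perm T) D r.2 s i = 0 := fun s => by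
    simp [flip, CharTwo.add_self_eq_zero]
  change x.2 r t i + flip 1 D r.2 _ i = _
  rw [this, add_zero]

/-- The construction is coherent, because flips are coboundaries. -/
theorem liftFun_comp {φ ψ : Equiv.Perm T} {D D' : Set T} (hD : ∀ x, φ x ∈ D' ↔ x ∈ D)
    (x : FlipExt L T) : liftFun ψ D' (liftFun φ D x) = liftFun (ψ * φ) D x := by
  refine Prod.ext rfl ?_
  funext r t i
  have h₁ : ∀ s : Fin r.1 → T, flip φ D r.2 s i + flip ψ D' r.2 (φ ∘ s) i =
      flip (ψ * φ) D r.2 s i := by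
    intro s
    simp only [flip, Function.comp_apply, hD]
    split_ifs
    · have : (ψ * φ : Equiv.Perm T) ∘ s = ψ ∘ φ ∘ s := rfl
      rw [this, add_assoc, ← add_assoc (ind r.2 (φ ∘ s)), CharTwo.add_self_eq_zero, zero_add]
    · simp
  have h₂ : Function.update (ψ.symm ∘ t) i (φ x.1) =
      φ ∘ Function.update (φ.symm ∘ ψ.symm ∘ t) i x.1 := by
    rw [Function.comp_update]
    congr 1
    ext j
    simp
  change x.2 r (φ.symm ∘ ψ.symm ∘ t) i + flip φ D r.2 _ i +
    flip ψ D' r.2 (Function.update (ψ.symm ∘ t) i (φ x.1)) i = _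
  rw [h₂, add_assoc, h₁]
  rfl

theorem liftFun_zeroFlip (φ : Equiv.Perm T) {D : Set T} {x : T} (hx : x ∈ D) :
    liftFun φ D (zeroFlip (L := L) x) = zeroFlip (φ x) := by
  refine Prod.ext rfl ?_
  funext r t i
  simp [liftFun, flip, zeroFlip, hx]

/-- The permutation of `FlipExt L T` induced by a permutation `φ` of `T` that is a partial
automorphism on `D`. -/
noncomputable def liftPerm (φ : Equiv.Perm T) (D : Set T) : Equiv.Perm (FlipExt L T) where
  toFun := liftFun φ D
  invFun := liftFun φ⁻¹ (φ '' D)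
  left_inv x := by
    rw [liftFun_comp (fun x => by simp), inv_mul_cancel, liftFun_one]
  right_inv x := by
    rw [liftFun_comp (fun x => by simp [Equiv.Perm.inv_def]),
      mul_inv_cancel, liftFun_one]

/-- The action on `FlipExt L T` induced by an action on `T` by partial automorphisms on an invariant
set `D`. -/
noncomputable def liftHom {G : Type*} [Group G] (a : G →* Equiv.Perm T) (D : Set T)
    (hD : ∀ g x, a g x ∈ D ↔ x ∈ D) : G →* Equiv.Perm (FlipExt L T) where
  toFun g := liftPerm (a g) D
  map_one' := by
    ext x : 1
    rw [map_one]
    exact liftFun_one D x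
  map_mul' g h := by
    ext x : 1
    rw [map_mul]
    exact (liftFun_comp (hD h) x).symm

variable [L.IsRelational]

/-- A tuple of `FlipExt L T` is in a relation if the tuple of first components is in the relation,
corrected by the sum of the flips of all entries. -/
noncomputable instance : L.Structure (FlipExt L T) where
  funMap f := isEmptyElim f
  RelMap {n} R x := ind R (fun i => (x i).1) + ∑ i, (x i).2 ⟨n, R⟩ (fun j => (x j).1) i = 1

theorem relMap_zeroFlip {n : ℕ} (R : L.Relations n) (t : Fin n → T) :
    RelMap R (zeroFlip (L := L) ∘ t) ↔ RelMap R t := by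
  change ind R t + ∑ i : Fin n, (0 : ZMod 2) = 1 ↔ _
  by_cases h : RelMap R t <;> simp [ind, h]

theorem relMap_liftFun {φ : Equiv.Perm T} {D : Set T}
    (hφ : ∀ (n : ℕ) (R : L.Relations n) (t : Fin n → T), (∀ i, t i ∈ D) →
      (RelMap R (φ ∘ t) ↔ RelMap R t)) {n : ℕ} (R : L.Relations n) (x : Fin n → FlipExt L T) :
    RelMap R (liftFun φ D ∘ x) ↔ RelMap R x := by
  let t : Fin n → T := fun i => (x i).1
  have h₁ : φ.symm ∘ (φ ∘ t) = t := by ext; simp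
  have h₂ : ∀ i, Function.update t i (x i).1 = t := fun i => Function.update_eq_self i t
  change ind R (φ ∘ t) + ∑ i, ((x i).2 ⟨n, R⟩ (φ.symm ∘ (φ ∘ t)) i +
    flip φ D R (Function.update (φ.symm ∘ (φ ∘ t)) i (x i).1) i) = 1 ↔
    ind R t + ∑ i, (x i).2 ⟨n, R⟩ t i = 1
  simp only [h₁, h₂]
  rw [Finset.sum_add_distrib, sum_flip hφ]
  have : ind R (φ ∘ t) + (∑ i, (x i).2 ⟨n, R⟩ t i + (ind R t + ind R (φ ∘ t))) =
      (ind R (φ ∘ t) + ind R (φ ∘ t)) + (ind R t + ∑ i, (x i).2 ⟨n, R⟩ t i) := by ring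
  rw [this, CharTwo.add_self_eq_zero, zero_add]

theorem isAut_liftPerm {φ : Equiv.Perm T} {D : Set T}
    (hφ : ∀ (n : ℕ) (R : L.Relations n) (t : Fin n → T), (∀ i, t i ∈ D) →
      (RelMap R (φ ∘ t) ↔ RelMap R t)) : IsAut (L := L) (liftPerm (L := L) φ D) :=
  fun _ R x => relMap_liftFun hφ R x

end Flip

/-! ### Destroying the cliques that do not embed -/

section CliqueExt

/-- The `m - 1` nonzero elements of `Fin (N + 1)` that are less than `m`. -/
def colours (N m : ℕ) : Finset (Fin (N + 1)) := {k | 0 < (k : ℕ) ∧ (k : ℕ) < m}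

theorem mem_colours {N m : ℕ} {k : Fin (N + 1)} :
    k ∈ colours N m ↔ 0 < (k : ℕ) ∧ (k : ℕ) < m := by
  simp [colours]

theorem zero_notMem_colours {N m : ℕ} : (0 : Fin (N + 1)) ∉ colours N m := by
  simp [mem_colours]

theorem card_colours {N m : ℕ} (h : m ≤ N + 1) : (colours N m).card = m - 1 := by
  have : (colours N m).map Fin.valEmbedding = Finset.Ioo 0 m := by
    ext k
    simp only [Finset.mem_map, mem_colours, Fin.valEmbedding_apply, Finset.mem_Ioo]
    constructor
    · rintro ⟨k, hk, rfl⟩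
      exact hk
    · intro hk
      exact ⟨⟨k, by omega⟩, hk, rfl⟩
  rw [← Finset.card_map Fin.valEmbedding, this, Nat.card_Ioo, Nat.sub_zero]

variable (L : FirstOrder.Language.{u, v}) (M : Type*) [L.Structure M] (B : Type*) [L.Structure B]
  [Fintype B] (G : Type*)

/-- Pairs of a point `b` of `B` and a colouring of the pairs `(u, h)`, where `h : G` and `u` is a
subset of `B` that does not embed in `M` and contains `b`. The colour of `(u, h)` is one of
`|u| - 1` colours. The value of the colouring is the junk value `0` on all other pairs. The second
index `h` is there to let `G` act. -/
def CliqueExt : Type _ :=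
  {x : B × (Finset B → G → Fin (Fintype.card B + 1)) // ∀ u h,
    if x.1 ∈ u ∧ ¬ EmbedsOn (L := L) M u then x.2 u h ∈ colours (Fintype.card B) u.card
    else x.2 u h = 0}

instance [Finite G] : Finite (CliqueExt L M B G) := Subtype.finite

variable {L M B G}

namespace CliqueExt

/-- The point of `B` underlying a point of `CliqueExt L M B G`. -/
def pt (x : CliqueExt L M B G) : B := x.1.1

/-- The colouring of a point of `CliqueExt L M B G`. -/
def col (x : CliqueExt L M B G) (u : Finset B) (h : G) : Fin (Fintype.card B + 1) := x.1.2 u h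

theorem ext {x y : CliqueExt L M B G} (h : x.pt = y.pt) (h' : ∀ u h, x.col u h = y.col u h) :
    x = y :=
  Subtype.ext (Prod.ext h (funext fun u => funext fun k => h' u k))

theorem col_mem (x : CliqueExt L M B G) {u : Finset B} (hx : x.pt ∈ u)
    (hu : ¬ EmbedsOn (L := L) M u) (h : G) : x.col u h ∈ colours (Fintype.card B) u.card := by
  have := x.2 u h
  rwa [if_pos ⟨hx, hu⟩] at this

theorem col_eq_zero (x : CliqueExt L M B G) {u : Finset B}
    (hu : ¬ (x.pt ∈ u ∧ ¬ EmbedsOn (L := L) M u)) (h : G) : x.col u h = 0 := by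
  have := x.2 u h
  rwa [if_neg (show ¬ (x.1.1 ∈ u ∧ _) from hu)] at this

/-- Two points are compatible if they are equal, or if they lie over different points of `B` and
their colours differ wherever both are defined. -/
def Compat (x y : CliqueExt L M B G) : Prop :=
  x = y ∨ x.pt ≠ y.pt ∧ ∀ u h, ¬ EmbedsOn (L := L) M u → x.pt ∈ u → y.pt ∈ u →
    x.col u h ≠ y.col u h

/-- The map of `CliqueExt L M B G` induced by an automorphism `β` of `B`, a permutation of the
second index and permutations `θ u h` of the colours. -/
noncomputable def moveFun (β : Equiv.Perm B) (hβ : IsAut (L := L) β) (σ : Equiv.Perm G)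
    (θ : Finset B → G → Equiv.Perm (Fin (Fintype.card B + 1)))
    (hθ : ∀ u h, (∀ k ∈ colours (Fintype.card B) u.card, θ u h k ∈
      colours (Fintype.card B) u.card) ∧ ∀ k ∉ colours (Fintype.card B) u.card, θ u h k = k)
    (x : CliqueExt L M B G) : CliqueExt L M B G :=
  ⟨(β x.pt, fun u h => θ u h (x.col (u.image β.symm) (σ h))), by
    intro u h
    have h₁ : x.pt ∈ u.image β.symm ↔ β x.pt ∈ u := by
      simp [Equiv.symm_apply_eq]
    have h₂ : EmbedsOn (L := L) M (u.image β.symm) ↔ EmbedsOn (L := L) M u :=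
      embedsOn_image_iff hβ.symm
    have h₃ : (u.image β.symm).card = u.card := Finset.card_image_of_injective _ β.symm.injective
    split_ifs with hu
    · refine (hθ u h).1 _ ?_
      rw [← h₃]
      exact x.col_mem (h₁.2 hu.1) (by rw [h₂]; exact hu.2) _
    · change θ u h (x.col _ _) = 0
      rw [x.col_eq_zero (by rw [h₁, h₂]; exact hu)]
      exact (hθ u h).2 0 zero_notMem_colours⟩

section Move

variable {β : Equiv.Perm B} {hβ : IsAut (L := L) β} {σ : Equiv.Perm G}
    {θ : Finset B → G → Equiv.Perm (Fin (Fintype.card B + 1))}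
    {hθ : ∀ u h, (∀ k ∈ colours (Fintype.card B) u.card, θ u h k ∈
      colours (Fintype.card B) u.card) ∧ ∀ k ∉ colours (Fintype.card B) u.card, θ u h k = k}

theorem pt_moveFun (x : CliqueExt L M B G) : (moveFun β hβ σ θ hθ x).pt = β x.pt := rfl

theorem col_moveFun (x : CliqueExt L M B G) (u : Finset B) (h : G) :
    (moveFun β hβ σ θ hθ x).col u h = θ u h (x.col (u.image β.symm) (σ h)) := rfl

theorem col_moveFun_image (x : CliqueExt L M B G) (u : Finset B) (h : G) :
    (moveFun β hβ σ θ hθ x).col (u.image β) (σ.symm h) =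
      θ (u.image β) (σ.symm h) (x.col u h) := by
  rw [col_moveFun, Finset.image_image, β.symm_comp_self, Finset.image_id, σ.apply_symm_apply]

theorem moveFun_injective : (moveFun (M := M) β hβ σ θ hθ).Injective := by
  intro x y hxy
  refine ext (β.injective (congrArg pt hxy)) fun u h => ?_
  have := congrArg (fun z => z.col (u.image β) (σ.symm h)) hxy
  simp only [col_moveFun_image] at this
  exact (θ _ _).injective this

theorem compat_moveFun {x y : CliqueExt L M B G} :
    Compat (moveFun β hβ σ θ hθ x) (moveFun β hβ σ θ hθ y) ↔ Compat x y := by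
  unfold Compat
  rw [moveFun_injective.eq_iff, pt_moveFun, pt_moveFun, β.injective.ne_iff]
  refine or_congr_right (and_congr_right fun _ => ⟨fun H u h hu hx hy => ?_,
    fun H u h hu hx hy => ?_⟩)
  · have := H (u.image β) (σ.symm h) (by rwa [embedsOn_image_iff hβ])
      (Finset.mem_image_of_mem _ hx) (Finset.mem_image_of_mem _ hy)
    rw [col_moveFun_image, col_moveFun_image] at this
    exact fun h => this (congrArg _ h)
  · rw [col_moveFun, col_moveFun, (θ u h).injective.ne_iff]
    refine H _ _ (by rwa [embedsOn_image_iff hβ.symm]) ?_ ?_ <;>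
      simpa [Equiv.symm_apply_eq] using ‹_›

end Move

/-- The automorphism of `CliqueExt L M B G` given by `moveFun`. -/
noncomputable def movePerm [Finite G] (β : Equiv.Perm B) (hβ : IsAut (L := L) β)
    (σ : Equiv.Perm G) (θ : Finset B → G → Equiv.Perm (Fin (Fintype.card B + 1)))
    (hθ : ∀ u h, (∀ k ∈ colours (Fintype.card B) u.card, θ u h k ∈
      colours (Fintype.card B) u.card) ∧ ∀ k ∉ colours (Fintype.card B) u.card, θ u h k = k) :
    Equiv.Perm (CliqueExt L M B G) :=
  Equiv.ofBijective (moveFun β hβ σ θ hθ) (Finite.injective_iff_bijective.1 moveFun_injective)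

/-- The action of `G` on `CliqueExt L M B G` induced by an action on `B`: the second index is
translated, and the colours are not permuted. -/
noncomputable def moveHom [Group G] [Finite G] (ρ : G →* Equiv.Perm B)
    (hρ : ∀ g, IsAut (L := L) (ρ g)) : G →* Equiv.Perm (CliqueExt L M B G) where
  toFun g := movePerm (ρ g) (hρ g) (Equiv.mulRight g) (fun _ _ => 1)
    fun _ _ => ⟨fun _ hk => hk, fun _ _ => rfl⟩
  map_one' := by
    ext x : 1
    refine ext ?_ fun u h => ?_
    · change ρ 1 x.pt = x.pt
      rw [map_one, Equiv.Perm.one_apply]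
    · change x.col (u.image (ρ 1).symm) (h * 1) = x.col u h
      rw [map_one, mul_one]
      congr 1
      exact Finset.image_id
  map_mul' g g' := by
    ext x : 1
    refine ext ?_ fun u h => ?_
    · change ρ (g * g') x.pt = ρ g (ρ g' x.pt)
      rw [map_mul, Equiv.Perm.mul_apply]
    · change x.col (u.image (ρ (g * g')).symm) (h * (g * g')) =
        x.col ((u.image (ρ g).symm).image (ρ g').symm) (h * g * g')
      rw [map_mul, mul_assoc, Finset.image_image]
      rfl

/-- A structure `T` embedded in `B` that embeds in `M` lifts to `CliqueExt L M B G`: a subset `u` of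
`B` that does not embed in `M` is not contained in `T`, so that `|u| - 1` colours suffice for the
points of `T` in `u`. The lift can be chosen compatibly with the action of `G` on an invariant
subset `S` of `T`. -/
theorem exists_lift [Group G] [Finite G] {T : Type*} [Fintype T] {e : T → B} (he : e.Injective)
    (hT : EmbedsOn (L := L) M (Finset.univ.image e)) {a : G →* Equiv.Perm T} {S : Set T}
    (hS : ∀ g, ∀ x ∈ S, a g x ∈ S) {ρ : G →* Equiv.Perm B} (hρ : ∀ g, IsAut (L := L) (ρ g))
    (hρe : ∀ g, ∀ x ∈ S, ρ g (e x) = e (a g x)) :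
    ∃ ν : T → CliqueExt L M B G, (∀ x, (ν x).pt = e x) ∧ (∀ x y, Compat (ν x) (ν y)) ∧
      ∀ g, ∀ x ∈ S, moveHom ρ hρ g (ν x) = ν (a g x) := by
  have hcard : ∀ u : Finset B, ¬ EmbedsOn (L := L) M u →
      (Finset.univ.filter fun x => e x ∈ u).card ≤ (colours (Fintype.card B) u.card).card := by
    intro u hu
    rw [card_colours ((Finset.card_le_univ _).trans (Nat.le_succ _)),
      ← Finset.card_image_of_injective _ he]
    refine Nat.le_sub_one_of_lt (Finset.card_lt_card ⟨?_, fun h => hu (hT.mono (h.trans ?_))⟩)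
    · intro b hb
      obtain ⟨x, hx, rfl⟩ := Finset.mem_image.1 hb
      simpa using hx
    · exact Finset.image_subset_image (Finset.subset_univ _)
  -- colours for the points of `S`
  have hV : ∀ u : Finset B, ∃ V : T → Fin (Fintype.card B + 1), ¬ EmbedsOn (L := L) M u →
      (∀ x y, e x ∈ u → e y ∈ u → V x = V y → x = y) ∧
      ∀ x, e x ∈ u → V x ∈ colours (Fintype.card B) u.card := by
    intro u
    by_cases hu : EmbedsOn (L := L) M u
    · exact ⟨fun _ => 0, fun h => absurd hu h⟩
    · obtain ⟨V, h₁, h₂, -⟩ := exists_injOn_extension (f := fun _ => 0) (Finset.empty_subset _)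
        (by simp) (by simp) (hcard u hu)
      exact ⟨V, fun _ => ⟨fun x y hx hy h => h₁ (by simpa using hx) (by simpa using hy) h,
        fun x hx => h₂ x (by simpa using hx)⟩⟩
  choose V hV using hV
  -- the colours of the points of `S` at `(u, h)` are transported from `h • u`, and extended to `T`
  have hE : ∀ (u : Finset B) (h : G), ∃ E : T → Fin (Fintype.card B + 1),
      (¬ EmbedsOn (L := L) M u → (∀ x y, e x ∈ u → e y ∈ u → E x = E y → x = y) ∧
        ∀ x, e x ∈ u → E x ∈ colours (Fintype.card B) u.card) ∧
      ∀ x ∈ S, E x = V (u.image (ρ h)) (a h x) := by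
    intro u h
    by_cases hu : EmbedsOn (L := L) M u
    · exact ⟨fun x => V (u.image (ρ h)) (a h x), fun h => absurd hu h, fun _ _ => rfl⟩
    · have hu' : ¬ EmbedsOn (L := L) M (u.image (ρ h)) := by rwa [embedsOn_image_iff (hρ h)]
      have hmem : ∀ x ∈ S, e x ∈ u → e (a h x) ∈ u.image (ρ h) := fun x hxS hx => by
        rw [← hρe h x hxS]
        exact Finset.mem_image_of_mem _ hx
      have hc : (u.image (ρ h)).card = u.card :=
        Finset.card_image_of_injective _ (ρ h).injective
      obtain ⟨E, h₁, h₂, h₃⟩ := exists_injOn_extension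
        (s := Finset.univ.filter fun x => e x ∈ u ∧ x ∈ S)
        (t := Finset.univ.filter fun x => e x ∈ u) (Q := colours (Fintype.card B) u.card)
        (f := fun x => V (u.image (ρ h)) (a h x))
        (fun x hx => by simp at hx ⊢; exact hx.1)
        (by
          intro x hx y hy hxy
          simp only [Finset.coe_filter, Finset.mem_univ, true_and, Set.mem_ofPred_eq] at hx hy
          exact (a h).injective ((hV _ hu').1 _ _ (hmem x hx.2 hx.1) (hmem y hy.2 hy.1) hxy))
        (by
          intro x hx
          simp only [Finset.mem_filter, Finset.mem_univ, true_and] at hx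
          rw [← hc]
          exact (hV _ hu').2 _ (hmem x hx.2 hx.1))
        (hcard u hu)
      refine ⟨E, fun _ => ⟨fun x y hx hy h => h₁ (by simpa using hx) (by simpa using hy) h,
        fun x hx => h₂ x (by simpa using hx)⟩, fun x hx => h₃ x ?_⟩
      simp [hx]
  choose E hE hES using hE
  refine ⟨fun x => ⟨(e x, fun u h => if e x ∈ u ∧ ¬ EmbedsOn (L := L) M u then E u h x else 0),
    fun u h => ?_⟩, fun x => rfl, fun x y => ?_, fun g x hx => ?_⟩
  · by_cases hu : e x ∈ u ∧ ¬ EmbedsOn (L := L) M u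
    · simp only [if_pos hu]
      exact (hE u h hu.2).2 x hu.1
    · simp only [if_neg hu]
  · by_cases hxy : x = y
    · exact Or.inl (by rw [hxy])
    · refine Or.inr ⟨he.ne hxy, fun u h hu hx hy heq => hxy ?_⟩
      change e x ∈ u at hx
      change e y ∈ u at hy
      simp only [col, hx, hy, hu, not_false_eq_true, and_self, if_true] at heq
      exact (hE u h hu).1 x y hx hy heq
  · refine ext (hρe g x hx) fun u h => ?_
    change (if e x ∈ u.image (ρ g).symm ∧ ¬ EmbedsOn (L := L) M (u.image (ρ g).symm) then
      E (u.image (ρ g).symm) (h * g) x else 0) =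
      if e (a g x) ∈ u ∧ ¬ EmbedsOn (L := L) M u then E u h (a g x) else 0
    have h₁ : e x ∈ u.image (ρ g).symm ↔ e (a g x) ∈ u := by
      rw [← hρe g x hx]
      simp [Equiv.symm_apply_eq]
    have h₂ : EmbedsOn (L := L) M (u.image (ρ g).symm) ↔ EmbedsOn (L := L) M u :=
      embedsOn_image_iff (hρ g).symm
    have h₃ : (u.image (ρ g).symm).image (ρ (h * g)) = u.image (ρ h) := by
      rw [Finset.image_image, map_mul, Equiv.Perm.coe_mul, Function.comp_assoc,
        Equiv.self_comp_symm, Function.comp_id]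
    simp only [h₁, h₂]
    rw [hES _ _ x hx, hES _ _ _ (hS g x hx), h₃, map_mul, Equiv.Perm.mul_apply]

variable [L.IsRelational]

/-- A tuple is in a relation if the tuple of underlying points of `B` is in the relation and its
entries are pairwise compatible. -/
instance : L.Structure (CliqueExt L M B G) where
  funMap f := isEmptyElim f
  RelMap R x := RelMap R (pt ∘ x) ∧ ∀ i j, Compat (x i) (x j)

theorem isAut_movePerm [Finite G] {β : Equiv.Perm B} {hβ : IsAut (L := L) β} {σ : Equiv.Perm G}
    {θ : Finset B → G → Equiv.Perm (Fin (Fintype.card B + 1))}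
    {hθ : ∀ u h, (∀ k ∈ colours (Fintype.card B) u.card, θ u h k ∈
      colours (Fintype.card B) u.card) ∧ ∀ k ∉ colours (Fintype.card B) u.card, θ u h k = k} :
    IsAut (L := L) (movePerm (M := M) β hβ σ θ hθ) := by
  intro n R x
  refine and_congr (hβ n R (pt ∘ x)) ?_
  exact forall₂_congr fun i j => compat_moveFun (hβ := hβ) (hθ := hθ)

/-- A clique `s` projects injectively to `B`, and its image `u` embeds in `M`: otherwise the
points of `s` would have pairwise distinct colours at `u`, but there are only `|u| - 1` colours. -/
theorem embedsOn_of_clique [Group G] (h₀ : EmbedsOn (L := L) M (∅ : Finset B))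
    {s : Finset (CliqueExt L M B G)} (hs : IsRelClique L s) : EmbedsOn (L := L) M s := by
  have hcompat : ∀ x ∈ s, ∀ y ∈ s, Compat x y := by
    intro x hx y hy
    by_cases hxy : x = y
    · exact Or.inl hxy
    · obtain ⟨n, R, t, hR, ⟨i, rfl⟩, ⟨j, rfl⟩⟩ := hs x hx y hy hxy
      exact hR.2 i j
  have hinj : Set.InjOn pt (s : Set (CliqueExt L M B G)) := fun x hx y hy hxy =>
    (hcompat x hx y hy).resolve_right fun h => h.1 hxy
  have hu : EmbedsOn (L := L) M (s.image pt) := by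
    by_contra hu
    have hle : s.card ≤ (colours (Fintype.card B) (s.image pt).card).card := by
      refine Finset.card_le_card_of_injOn (fun x => x.col (s.image pt) 1)
        (fun x hx => x.col_mem (Finset.mem_image_of_mem _ hx) hu 1) ?_
      intro x hx y hy hxy
      exact (hcompat x hx y hy).resolve_right fun h => h.2 _ 1 hu
        (Finset.mem_image_of_mem _ hx) (Finset.mem_image_of_mem _ hy) hxy
    rw [card_colours ((Finset.card_le_univ _).trans (Nat.le_succ _)),
      Finset.card_image_of_injOn hinj] at hle
    have : s.card = 0 := by omega
    rw [Finset.card_eq_zero.1 this, Finset.image_empty] at hu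
    exact hu h₀
  obtain ⟨f, hf, hR⟩ := hu
  refine ⟨f ∘ pt, ?_, fun n R t ht => ?_⟩
  · intro x hx y hy hxy
    exact hinj hx hy (hf (Finset.mem_coe.2 (Finset.mem_image_of_mem _ hx))
      (Finset.mem_coe.2 (Finset.mem_image_of_mem _ hy)) hxy)
  · rw [Function.comp_assoc, hR n R (pt ∘ t) fun i => Finset.mem_image_of_mem _ (ht i)]
    exact ⟨fun h => ⟨h, fun i j => hcompat _ (ht i) _ (ht j)⟩, fun h => h.1⟩

/-- An automorphism of `B` that restricts to a partial map `p` of `T` on `D` lifts to an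
automorphism extending the partial map that `p` induces on the lift of `T`: permute the colours at
each `u` suitably. -/
theorem exists_aut_extending [Finite G] {T : Type*} {e : T → B} {ν : T → CliqueExt L M B G}
    (he : e.Injective) (hν : ∀ x, (ν x).pt = e x) (hcompat : ∀ x y, Compat (ν x) (ν y))
    {β : Equiv.Perm B} (hβ : IsAut (L := L) β) {D : Set T} {p : T → T}
    (hp : ∀ x ∈ D, β (e x) = e (p x)) :
    ∃ τ : Equiv.Perm (CliqueExt L M B G), IsAut (L := L) τ ∧ ∀ x ∈ D, τ (ν x) = ν (p x) := by
  have hne : ∀ u h x y, ¬ EmbedsOn (L := L) M u → e x ∈ u → e y ∈ u →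
      (ν x).col u h = (ν y).col u h → x = y := by
    intro u h x y hu hx hy hxy
    rcases hcompat x y with H | H
    · rw [← he.eq_iff, ← hν, ← hν, H]
    · exact absurd hxy (H.2 u h hu (by rwa [hν]) (by rwa [hν]))
  have hθ : ∀ (u : Finset B) (h : G), ∃ θ : Equiv.Perm (Fin (Fintype.card B + 1)),
      (∀ x, (x ∈ D ∧ e (p x) ∈ u ∧ ¬ EmbedsOn (L := L) M u) →
        θ ((ν x).col (u.image β.symm) h) = (ν (p x)).col u h) ∧
      (∀ k ∈ colours (Fintype.card B) u.card, θ k ∈ colours (Fintype.card B) u.card) ∧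
      ∀ k ∉ colours (Fintype.card B) u.card, θ k = k := by
    intro u h
    have h₁ : ∀ x ∈ D, e (p x) ∈ u → e x ∈ u.image β.symm := by
      intro x hx hxu
      refine Finset.mem_image.2 ⟨e (p x), hxu, ?_⟩
      rw [← hp x hx, Equiv.symm_apply_apply]
    have h₂ : EmbedsOn (L := L) M (u.image β.symm) ↔ EmbedsOn (L := L) M u :=
      embedsOn_image_iff hβ.symm
    have h₃ : (u.image β.symm).card = u.card := Finset.card_image_of_injective _ β.symm.injective
    refine exists_perm_of_injOn
      (D := {x | x ∈ D ∧ e (p x) ∈ u ∧ ¬ EmbedsOn (L := L) M u})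
      (f := fun x => (ν x).col (u.image β.symm) h) (g := fun x => (ν (p x)).col u h) ?_ ?_ ?_ ?_
    · rintro x ⟨hx, hxu, hu⟩ y ⟨hy, hyu, -⟩ hxy
      exact hne _ h x y (by rwa [h₂]) (h₁ x hx hxu) (h₁ y hy hyu) hxy
    · rintro x ⟨hx, hxu, hu⟩ y ⟨hy, hyu, -⟩ hxy
      have := congrArg e (hne _ h _ _ hu hxu hyu hxy)
      rw [← hp x hx, ← hp y hy] at this
      exact he (β.injective this)
    · rintro x ⟨hx, hxu, hu⟩
      rw [← h₃]
      exact (ν x).col_mem (by rw [hν]; exact h₁ x hx hxu) (by rwa [h₂]) h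
    · rintro x ⟨hx, hxu, hu⟩
      exact (ν (p x)).col_mem (by rwa [hν]) hu h
  choose θ hθ hθ' using hθ
  refine ⟨movePerm β hβ 1 θ hθ', isAut_movePerm, fun x hx => ?_⟩
  refine ext ?_ fun u h => ?_
  · change β (ν x).pt = (ν (p x)).pt
    rw [hν, hν, hp x hx]
  · change θ u h ((ν x).col (u.image β.symm) h) = (ν (p x)).col u h
    by_cases hu : e (p x) ∈ u ∧ ¬ EmbedsOn (L := L) M u
    · exact hθ u h x ⟨hx, hu⟩
    · rw [(ν (p x)).col_eq_zero (by rwa [hν]), (ν x).col_eq_zero]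
      · exact (hθ' u h).2 0 zero_notMem_colours
      · rw [hν, embedsOn_image_iff hβ.symm]
        simpa [Equiv.symm_apply_eq, hp x hx] using hu

end CliqueExt

end CliqueExt

/-! ### Automorphisms of finite substructures -/

section AutOn

variable (L : FirstOrder.Language.{u, v}) {M : Type w} [L.Structure M]

/-- The automorphism group of the substructure of `M` on the finite set `S`. Its elements are
encoded as permutations of `M` that fix all points outside `S`. -/
def autOn (S : Finset M) : Subgroup (Equiv.Perm M) where
  carrier := {σ | (∀ x ∉ S, σ x = x) ∧ ∀ (n : ℕ) (R : L.Relations n) (t : Fin n → M),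
    (∀ i, t i ∈ S) → (RelMap R (σ ∘ t) ↔ RelMap R t)}
  one_mem' := ⟨fun _ _ => rfl, fun _ _ _ _ => Iff.rfl⟩
  mul_mem' {σ τ} hσ hτ := by
    refine ⟨fun x hx => ?_, fun n R t ht => ?_⟩
    · rw [Equiv.Perm.mul_apply, hτ.1 x hx, hσ.1 x hx]
    · rw [Equiv.Perm.coe_mul, Function.comp_assoc, hσ.2 n R (τ ∘ t), hτ.2 n R t ht]
      intro i
      by_contra hi
      exact hi (by rw [Function.comp_apply, τ.injective (hτ.1 _ hi)]; exact ht i)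
  inv_mem' {σ} hσ := by
    refine ⟨fun x hx => ?_, fun n R t ht => ?_⟩
    · rw [Equiv.Perm.inv_eq_iff_eq, hσ.1 x hx]
    · rw [← hσ.2 n R, ← Function.comp_assoc, ← Equiv.Perm.coe_mul, mul_inv_cancel]
      · rfl
      · intro i
        by_contra hi
        have h : σ⁻¹ (t i) = t i := (hσ.1 _ hi).symm.trans (σ.apply_symm_apply (t i))
        exact hi (by rw [Function.comp_apply, h]; exact ht i)

variable {L}

theorem apply_mem_of_mem_autOn {S : Finset M} {σ : Equiv.Perm M} (hσ : σ ∈ autOn L S) {x : M}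
    (hx : x ∈ S) : σ x ∈ S := by
  by_contra h
  exact h (by rwa [σ.injective (hσ.1 _ h)])

theorem apply_mem_iff_of_mem_autOn {S T : Finset M} (hST : S ⊆ T) {σ : Equiv.Perm M}
    (hσ : σ ∈ autOn L S) (x : M) : σ x ∈ T ↔ x ∈ T := by
  by_cases hx : x ∈ S
  · exact iff_of_true (hST (apply_mem_of_mem_autOn hσ hx)) (hST hx)
  · rw [hσ.1 x hx]

theorem autOn_ext {S : Finset M} {σ τ : autOn L S}
    (h : ∀ x ∈ S, (σ : Equiv.Perm M) x = (τ : Equiv.Perm M) x) : σ = τ := by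
  ext x
  by_cases hx : x ∈ S
  · exact h x hx
  · rw [σ.2.1 x hx, τ.2.1 x hx]

instance (S : Finset M) : Finite (autOn L S) := by
  refine Finite.of_injective
    (fun (σ : autOn L S) (x : S) => (⟨σ.1 x, apply_mem_of_mem_autOn σ.2 x.2⟩ : S)) ?_
  intro σ τ h
  exact autOn_ext fun x hx => congrArg Subtype.val (congrFun h ⟨x, hx⟩)

theorem viaEmbedding_mem_autOn {C : Type*} [Fintype C] [L.Structure C] (f : C ↪[L] M)
    {τ : Equiv.Perm C} (hτ : IsAut (L := L) τ) :
    τ.viaEmbedding f.toEmbedding ∈ autOn L (Finset.univ.image f) := by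
  refine ⟨fun x hx => ?_, fun n R t ht => ?_⟩
  · refine Equiv.Perm.viaEmbedding_apply_of_notMem _ _ _ ?_
    rintro ⟨c, rfl⟩
    exact hx (Finset.mem_image_of_mem _ (Finset.mem_univ c))
  · have : ∀ i, ∃ c, f c = t i := fun i => by simpa using ht i
    choose s hs using this
    obtain rfl : f ∘ s = t := funext hs
    have : τ.viaEmbedding f.toEmbedding ∘ (f ∘ s) = f ∘ (τ ∘ s) :=
      funext fun i => Equiv.Perm.viaEmbedding_apply τ f.toEmbedding (s i)
    rw [this, f.map_rel, f.map_rel, hτ]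

/-- The finite step: any finite substructure `T` of `M` is contained in a finite substructure `S'`
such that every partial automorphism of `T` extends to an automorphism of `S'`, and the
automorphism group of a given substructure `S` of `T` extends to `S'` as a group. -/
theorem exists_finite_extension [L.IsRelational] [Finite (Σ n, L.Relations n)]
    (hM : L.IsUltrahomogeneous M) (hfree : FreeAmalgamationProperty (L.age M)) {S T : Finset M}
    (hST : S ⊆ T) :
    ∃ (S' : Finset M) (ρ : autOn L S →* autOn L S'), T ⊆ S' ∧
      (∀ σ, ∀ x ∈ S, (ρ σ : Equiv.Perm M) x = (σ : Equiv.Perm M) x) ∧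
      ∀ (g : M ≃[L] M) (D : Finset M), D ⊆ T → (∀ x ∈ D, g x ∈ T) →
        ∃ τ : autOn L S', ∀ x ∈ D, (τ : Equiv.Perm M) x = g x := by
  let : L.Structure T := pullback Subtype.val
  let B := FlipExt L T
  let : Fintype B := Fintype.ofFinite B
  let e : T → B := zeroFlip
  -- the action of `autOn L S` on `T` and on `B`
  let a : autOn L S →* Equiv.Perm T :=
    { toFun := fun σ => σ.1.subtypePerm (apply_mem_iff_of_mem_autOn hST σ.2)
      map_one' := rfl
      map_mul' := fun _ _ => rfl }
  let S₀ : Set T := {x | x.1 ∈ S}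
  have hS₀ : ∀ σ x, a σ x ∈ S₀ ↔ x ∈ S₀ := fun σ x =>
    apply_mem_iff_of_mem_autOn (Finset.Subset.refl S) σ.2 x.1
  let ρB : autOn L S →* Equiv.Perm B := liftHom a S₀ hS₀
  have hρB : ∀ σ, IsAut (L := L) (ρB σ) := fun σ =>
    isAut_liftPerm fun n R t ht => σ.2.2 n R (Subtype.val ∘ t) ht
  have hT : EmbedsOn (L := L) M (Finset.univ.image e) := by
    refine ⟨fun b => b.1.1, ?_, fun n R t ht => ?_⟩
    · intro b hb b' hb' h
      simp only [Finset.coe_image, Finset.coe_univ, Set.image_univ] at hb hb'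
      obtain ⟨x, rfl⟩ := hb
      obtain ⟨x', rfl⟩ := hb'
      exact congrArg e (Subtype.ext h)
    · have : ∀ i, ∃ x, e x = t i := fun i => by simpa using ht i
      choose s hs using this
      obtain rfl : e ∘ s = t := funext hs
      exact (relMap_zeroFlip R s).symm
  obtain ⟨ν, hν, hcompat, hνa⟩ := CliqueExt.exists_lift (M := M) zeroFlip_injective hT (a := a)
    (fun σ x hx => (hS₀ σ x).2 hx) hρB fun σ x hx => liftFun_zeroFlip (a σ) hx
  let C := CliqueExt L M B (autOn L S)
  let : Fintype C := Fintype.ofFinite C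
  obtain ⟨f₀, hf₀, hf₀R⟩ := embedsOn_of_forall_clique hfree
    (fun s hs => CliqueExt.embedsOn_of_clique (hT.mono (Finset.empty_subset _)) hs)
    (Finset.univ : Finset C)
  have : Nonempty (C ↪[L] M) := ⟨mkEmbedding f₀ (fun x y h => hf₀ (by simp) (by simp) h)
    fun n R t => hf₀R n R t fun i => Finset.mem_univ _⟩
  -- by homogeneity, the embedding of `C` in `M` can be chosen to be the identity on `T`
  obtain ⟨f, hf⟩ := hM.extend_embedding (S := T) (T := C) Structure.FG.of_finite
    (mkEmbedding Subtype.val Subtype.val_injective fun _ _ _ => Iff.rfl)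
    (mkEmbedding ν
      (fun x y h => zeroFlip_injective (by
        have := congrArg CliqueExt.pt h
        rwa [hν, hν] at this))
      fun n R t => by
        have : CliqueExt.pt ∘ (ν ∘ t) = e ∘ t := funext fun i => hν _
        change (RelMap R (CliqueExt.pt ∘ (ν ∘ t)) ∧ _) ↔ _
        rw [this, relMap_zeroFlip]
        exact and_iff_left fun i j => hcompat _ _)
  have hfν : ∀ x : T, f (ν x) = x := fun x => (DFunLike.congr_fun hf x).symm
  have hvia : ∀ (τ : Equiv.Perm C) (x : T), τ.viaEmbedding f.toEmbedding x = f (τ (ν x)) := by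
    intro τ x
    rw [← hfν x]
    exact Equiv.Perm.viaEmbedding_apply τ f.toEmbedding (ν x)
  refine ⟨Finset.univ.image f,
    ((Equiv.Perm.viaEmbeddingHom f.toEmbedding).comp (CliqueExt.moveHom ρB hρB)).codRestrict _
      fun σ => viaEmbedding_mem_autOn f CliqueExt.isAut_movePerm, fun x hx => ?_,
    fun σ x hx => ?_, fun g D hD hgD => ?_⟩
  · exact Finset.mem_image.2 ⟨ν ⟨x, hx⟩, Finset.mem_univ _, hfν ⟨x, hx⟩⟩
  · refine (hvia _ ⟨x, hST hx⟩).trans ?_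
    rw [hνa σ ⟨x, hST hx⟩ hx, hfν]
    rfl
  · obtain ⟨φ, hφ⟩ := exists_perm_of_injective
      (f := fun x : D => (⟨x, hD x.2⟩ : T)) (g := fun x : D => (⟨g x, hgD x x.2⟩ : T))
      (fun x y h => Subtype.ext (Subtype.mk.inj h))
      (fun x y h => Subtype.ext (g.injective (Subtype.mk.inj h)))
    let D₀ : Set T := {x | x.1 ∈ D}
    have hφD : ∀ x ∈ D₀, (φ x : M) = g x := fun x hx => congrArg Subtype.val (hφ ⟨x, hx⟩)
    have hβ : IsAut (L := L) (liftPerm (L := L) φ D₀) := by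
      refine isAut_liftPerm fun n R t ht => ?_
      change RelMap R (Subtype.val ∘ (φ ∘ t)) ↔ RelMap R (Subtype.val ∘ t)
      have : Subtype.val ∘ (φ ∘ t) = g ∘ (Subtype.val ∘ t) := funext fun i => hφD _ (ht i)
      rw [this, g.map_rel]
    obtain ⟨τ, hτ, hτν⟩ := CliqueExt.exists_aut_extending (e := e) zeroFlip_injective hν hcompat hβ
      (D := D₀) (p := φ) fun x hx => liftFun_zeroFlip φ hx
    refine ⟨⟨_, viaEmbedding_mem_autOn f hτ⟩, fun x hx => ?_⟩
    refine (hvia τ ⟨x, hD hx⟩).trans ?_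
    rw [hτν ⟨x, hD hx⟩ hx, hfν, hφD ⟨x, hD hx⟩ hx]

end AutOn

/-! ### The union of a chain of finite automorphism groups -/

section Chain

variable {L : FirstOrder.Language.{u, v}} {M : Type w} [L.Structure M]

/-- The automorphisms of `M` that, from the index `i` on, restrict to all members of the chain `S`,
with restrictions corresponding to each other under the homomorphisms `r`. -/
def chainSubgroup {S : ℕ → Finset M} (r : ∀ i, autOn L (S i) →* autOn L (S (i + 1))) (i : ℕ) :
    Subgroup (M ≃[L] M) where
  carrier := {h | ∀ j ≥ i, ∃ σ : autOn L (S j), (∀ x ∈ S j, (σ : Equiv.Perm M) x = h x) ∧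
    ∀ x ∈ S (j + 1), (r j σ : Equiv.Perm M) x = h x}
  one_mem' j _ := ⟨1, fun _ _ => rfl, fun _ _ => by rw [map_one]; rfl⟩
  mul_mem' {h k} hh hk j hj := by
    obtain ⟨σ, h₁, h₂⟩ := hh j hj
    obtain ⟨τ, h₃, h₄⟩ := hk j hj
    refine ⟨σ * τ, fun x hx => ?_, fun x hx => ?_⟩
    · change σ.1 (τ.1 x) = h (k x)
      rw [h₁ _ (apply_mem_of_mem_autOn τ.2 hx), h₃ x hx]
    · rw [map_mul]
      change (r j σ).1 ((r j τ).1 x) = h (k x)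
      rw [h₂ _ (apply_mem_of_mem_autOn (r j τ).2 hx), h₄ x hx]
  inv_mem' {h} hh j hj := by
    obtain ⟨σ, h₁, h₂⟩ := hh j hj
    have key : ∀ {s : Finset M} (τ : autOn L s), (∀ x ∈ s, τ.1 x = h x) →
        ∀ x ∈ s, (τ⁻¹).1 x = h⁻¹ x := by
      intro s τ hτ x hx
      apply h.injective
      rw [← hτ _ (apply_mem_of_mem_autOn (τ⁻¹).2 hx)]
      exact (τ.1.apply_symm_apply x).trans (h.toEquiv.apply_symm_apply x).symm
    exact ⟨σ⁻¹, key σ h₁, by rw [map_inv]; exact key _ h₂⟩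

variable {S : ℕ → Finset M} {r : ∀ i, autOn L (S i) →* autOn L (S (i + 1))}

theorem chainSubgroup_mono : Monotone (chainSubgroup r) :=
  fun _ _ hij _ hh j hj => hh j (hij.trans hj)

theorem finite_chainSubgroup (hS : ∀ i, S i ⊆ S (i + 1)) (hcov : ∀ x, ∃ i, x ∈ S i) (i : ℕ) :
    Finite (chainSubgroup r i) := by
  have hmono : Monotone S := monotone_nat_of_le_succ hS
  choose σ hσ using fun h : chainSubgroup r i => h.2 i le_rfl
  refine Finite.of_injective σ fun h k hhk => ?_
  have key : ∀ j ≥ i, ∀ x ∈ S j, h.1 x = k.1 x := by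
    intro j hj
    induction j, hj using Nat.le_induction with
    | base => exact fun x hx => by rw [← (hσ h).1 x hx, ← (hσ k).1 x hx, hhk]
    | succ j hj ih =>
      intro x hx
      obtain ⟨a, h₁, h₂⟩ := h.2 j hj
      obtain ⟨b, h₃, h₄⟩ := k.2 j hj
      have : a = b := autOn_ext fun y hy => by rw [h₁ y hy, h₃ y hy, ih y hy]
      rw [← h₂ x hx, ← h₄ x hx, this]
  refine Subtype.ext (FirstOrder.Language.Equiv.ext fun x => ?_)
  obtain ⟨j, hj⟩ := hcov x
  exact key (max i j) (le_max_left _ _) x (hmono (le_max_right _ _) hj)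

theorem exists_mem_chainSubgroup [L.IsRelational] (hS : ∀ i, S i ⊆ S (i + 1))
    (hcov : ∀ x, ∃ i, x ∈ S i)
    (hr : ∀ i σ, ∀ x ∈ S i, (r i σ : Equiv.Perm M) x = (σ : Equiv.Perm M) x) (i : ℕ)
    (τ : autOn L (S i)) :
    ∃ h ∈ chainSubgroup r i, ∀ x ∈ S i, h x = (τ : Equiv.Perm M) x := by
  have hmono : Monotone S := monotone_nat_of_le_succ hS
  let q : ∀ k, autOn L (S (i + k)) := fun k => Nat.rec τ (fun k σ => r (i + k) σ) k
  have hq : ∀ k l, ∀ x ∈ S (i + k), (q (k + l)).1 x = (q k).1 x := by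
    intro k l x hx
    induction l with
    | zero => rfl
    | succ l ih =>
      rw [← ih]
      exact hr (i + (k + l)) (q (k + l)) x (hmono (by omega) hx)
  have hcov' : ∀ x, ∃ k, x ∈ S (i + k) := fun x =>
    (hcov x).imp fun j hj => hmono (Nat.le_add_left j i) hj
  choose d hd using hcov'
  let F : M → M := fun x => (q (d x)).1 x
  have hF : ∀ k, ∀ x ∈ S (i + k), F x = (q k).1 x := by
    intro k x hx
    have hcongr : ∀ a b, a = b → (q a).1 x = (q b).1 x := by
      rintro a _ rfl
      rfl
    exact (hq (d x) k x (hd x)).symm.trans ((hcongr _ _ (add_comm _ _)).trans (hq k (d x) x hx))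
  have hFbij : F.Bijective := by
    constructor
    · intro x y hxy
      have hx : x ∈ S (i + (d x + d y)) := hmono (by omega) (hd x)
      have hy : y ∈ S (i + (d x + d y)) := hmono (by omega) (hd y)
      rw [hF _ x hx, hF _ y hy] at hxy
      exact (q _).1.injective hxy
    · intro y
      refine ⟨(q (d y))⁻¹.1 y, ?_⟩
      rw [hF _ _ (apply_mem_of_mem_autOn (q (d y))⁻¹.2 (hd y))]
      exact (q (d y)).1.apply_symm_apply y
  let h : M ≃[L] M :=
    { Equiv.ofBijective F hFbij with
      map_fun' := fun f => isEmptyElim f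
      map_rel' := fun {n} R t => by
        let k := Finset.univ.sup fun j => d (t j)
        have hk : ∀ j, t j ∈ S (i + k) := fun j =>
          hmono (Nat.add_le_add_left (Finset.le_sup (f := fun j => d (t j))
            (Finset.mem_univ j)) i) (hd (t j))
        have : F ∘ t = (q k).1 ∘ t := funext fun j => hF k _ (hk j)
        change RelMap R (F ∘ t) ↔ _
        rw [this]
        exact (q k).2.2 n R t hk }
  refine ⟨h, fun j hj => ?_, fun x hx => hF 0 x hx⟩
  obtain ⟨k, rfl⟩ := Nat.exists_eq_add_of_le hj
  exact ⟨q k, fun x hx => (hF k x hx).symm, fun x hx => (hF (k + 1) x hx).symm⟩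

/-- A finitely generated subgroup of the union of the chain lies in one of its finite members. -/
theorem isLocallyFiniteGroup_iSup {G : Type*} [Group G] {H : ℕ → Subgroup G} (hH : Monotone H)
    (hfin : ∀ i, Finite (H i)) : IsLocallyFiniteGroup ↥(⨆ i, H i) := by
  rintro K ⟨t, rfl⟩
  have hmem : ∀ x : ↥(⨆ i, H i), ∃ i, x.1 ∈ H i := fun x =>
    (Subgroup.mem_iSup_of_directed hH.directed_le).1 x.2
  choose d hd using hmem
  have hle : Subgroup.closure (t : Set ↥(⨆ i, H i)) ≤
      (H (t.sup d)).comap (Subgroup.subtype _) := by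
    rw [Subgroup.closure_le]
    exact fun x hx => hH (Finset.le_sup (f := d) hx) (hd x)
  refine Finite.of_injective (β := H (t.sup d)) (fun x => ⟨x.1.1, hle x.2⟩) fun x y hxy => ?_
  exact Subtype.ext (Subtype.ext (Subtype.mk.inj hxy))

/-- A set of automorphisms is dense if it contains approximations of every automorphism on every
finite set. -/
theorem dense_of_forall_finset {H : Set (M ≃[L] M)}
    (h : ∀ (g : M ≃[L] M) (D : Finset M), ∃ k ∈ H, ∀ x ∈ D, k x = g x) : Dense H := by
  let : TopologicalSpace M := ⊥
  intro g
  rw [mem_closure_iff]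
  intro U hU hgU
  obtain ⟨V, hV, rfl⟩ := isOpen_induced_iff.1 hU
  obtain ⟨D, W, hW, hWV⟩ := isOpen_pi_iff.1 hV _ hgU
  obtain ⟨k, hk, hkg⟩ := h g D
  refine ⟨k, hWV fun x hx => ?_, hk⟩
  change k x ∈ W x
  rw [hkg x hx]
  exact (hW x hx).2

end Chain

end FreeHomogeneous

theorem corollary5p2 (L : FirstOrder.Language.{u, v}) [L.IsRelational] [Finite L.Symbols]
    (M : Type w) [L.Structure M] [Countable M]
    (hM : FreeHomogeneous.IsFreeHomogeneous L M) :
    ∃ H : Subgroup (M ≃[L] M),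
      Dense (H : Set (M ≃[L] M)) ∧ FreeHomogeneous.IsLocallyFiniteGroup H := by
  classical
  open FreeHomogeneous in
  obtain ⟨K, hK, hlim⟩ := hM
  have hfree : FreeAmalgamationProperty (L.age M) := by
    rw [hlim.age]
    exact hK.free
  have : Finite (Σ n, L.Relations n) :=
    Finite.of_injective (Sum.inr : _ → L.Symbols) Sum.inr_injective
  let := Encodable.ofCountable M
  choose N ρ hN hρ hext using fun (i : ℕ) (S : Finset M) =>
    exists_finite_extension (S := S) (T := S ∪ (Encodable.decode (α := M) i).toFinset)
      hlim.ultrahomogeneous hfree Finset.subset_union_left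
  let S : ℕ → Finset M := fun n => Nat.rec ∅ (fun i S => N i S) n
  let r : ∀ i, autOn L (S i) →* autOn L (S (i + 1)) := fun i => ρ i (S i)
  have hS : ∀ i, S i ⊆ S (i + 1) := fun i => Finset.subset_union_left.trans (hN i (S i))
  have hcov : ∀ x, ∃ i, x ∈ S i := fun x =>
    ⟨Encodable.encode x + 1, hN _ _ (Finset.mem_union_right _ (by simp))⟩
  have hmono : Monotone S := monotone_nat_of_le_succ hS
  refine ⟨⨆ i, chainSubgroup r i, dense_of_forall_finset fun g D => ?_,
    isLocallyFiniteGroup_iSup chainSubgroup_mono (finite_chainSubgroup hS hcov)⟩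
  choose d hd using hcov
  let i := (D ∪ D.image g).sup d
  have hi : ∀ x ∈ D ∪ D.image g, x ∈ S i := fun x hx => hmono (Finset.le_sup (f := d) hx) (hd x)
  obtain ⟨τ, hτ⟩ := hext i (S i) g D
    (fun x hx => Finset.mem_union_left _ (hi x (Finset.mem_union_left _ hx)))
    (fun x hx => Finset.mem_union_left _
      (hi _ (Finset.mem_union_right _ (Finset.mem_image_of_mem g hx))))
  obtain ⟨h, hh, hhτ⟩ := exists_mem_chainSubgroup (r := r) hS
    (fun x => ⟨d x, hd x⟩) (fun i => hρ i (S i)) (i + 1) τ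
  refine ⟨h, (le_iSup (chainSubgroup r) (i + 1)) hh, fun x hx => ?_⟩
  rw [hhτ x (hS i (hi x (Finset.mem_union_left _ hx))), hτ x hx]
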